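/- A \emph{catoid} $(C,\odot,s,t)$ is a set $C$ with maps $\odot:C\times C\to\mathcal P(C)$ and $s,t:C\to C$ such that, for all $x,y,z\in C$, $\bigcup_{v\in y\odot z}x\odot v=\bigcup_{u\in x\odot y}u\odot z$; $x\odot y\ne\emptyset$ implies $t(x)=s(y)$; $s(x)\odot x=\{x\}$; and $x\odot t(x)=\{x\}$. For $X,Y\subseteq C$ put $X\odot Y=\bigcup_{x\in X,y\in Y}x\odot y$. Its \emph{identities} are the fixpoints of $s$ (equivalently, of $t$). It is \emph{local} if $t(x)=s(y)$ implies $x\odot y\neq\emptyset$; \emph{finitely $2$-decomposable} if for every $x$ there are only finitely many pairs $(y,z)$ of non-identity elements with $x\in y\odot z$; and of \emph{finite valency} if for every identity $e$ the sets $\{x\mid s(x)=e\}$ and $\{x\mid t(x)=e\}$ are finite. An \emph{$n$-catoid} is a structure $(C,\odot_i,s_i,t_i)_{0\le i<n}$ such that each $(C,\odot_i,s_i,t_i)$ is a catoid; for all $i\ne j$, each of $s_i,t_i$ commutes with each of $s_j,t_j$, and $s_i(x\odot_j y)\subseteq s_i(x)\odot_j s_i(y)$ and $t_i(x\odot_j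 y)\subseteq t_i(x)\odot_j t_i(y)$; and for all $i<j$, $$(w\odot_j x)\odot_i(y\odot_j z)\subseteq(w\odot_i y)\odot_j(x\odot_i z),$$ $$s_j\circ s_i=s_i,\quad s_j\circ t_i=t_i,\quad t_j\circ s_i=s_i,\quad t_j\circ t_i=t_i,$$ $$s_j(s_j(x)\odot_i s_j(y))=s_j(x)\odot_i s_j(y),\qquad t_j(t_j(x)\odot_i t_j(y))=t_j(x)\odot_i t_j(y).$$ It is local, finitely $2$-decomposable, or of finite valency if each $(C,\odot_i,s_i,t_i)$ is. A \emph{modal semiring} $(S,+,0,\cdot,1,d^-,d^+)$ is an additively idempotent semiring, ordered by $\alpha\le\beta\Leftrightarrow\alpha+\beta=\beta$, with maps $d^-,d^+:S\to S$ such that $$\alpha\le d^-(\alpha)\cdot\alpha,\quad d^-(\alpha\cdot d^-(\beta))=d^-(\alpha\cdot\beta),\quad d^-(\alpha)\le 1,\quad d^-(0)=0,\quad d^-(\alpha+\beta)=d^-(\alpha)+d^-(\beta),$$ $$\alpha\le\alpha\cdot d^+(\alpha),\quad d^+(d^+(\alpha)\cdot\beta)=d^+(\alpha\cdot\beta),\quad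 d^+(\alpha)\le 1,\quad d^+(0)=0,\quad d^+(\alpha+\beta)=d^+(\alpha)+d^+(\beta),$$ $$d^+(d^-(\alpha))=d^-(\alpha),\qquad d^-(d^+(\alpha))=d^+(\alpha).$$ An \emph{$n$-semiring} is a structure $(S,+,0,\cdot_i,1_i,d^-_i,d^+_i)_{0\le i<n}$, with $(S,+,0)$ a commutative monoid, such that each $(S,+,0,\cdot_i,1_i,d^-_i,d^+_i)$ is a modal semiring; for all $i\neq j$, $$d^-_i(\alpha\cdot_j\beta)\le d^-_i(\alpha)\cdot_j d^-_i(\beta),\qquad d^+_i(\alpha\cdot_j\beta)\le d^+_i(\alpha)\cdot_j d^+_i(\beta);$$ and for all $i<j$, $$(\alpha\cdot_j\beta)\cdot_i(\gamma\cdot_j\delta)\le(\alpha\cdot_i\gamma)\cdot_j(\beta\cdot_i\delta),\qquad d^-_j(d^-_i(\alpha))=d^-_i(\alpha),$$ $$d^-_j(d^-_j(\alpha)\cdot_i d^-_j(\beta))=d^-_j(\alpha)\cdot_i d^-_j(\beta),\qquad d^+_j(d^+_j(\alpha)\cdot_i d^+_j(\beta))=d^+_j(\alpha)\cdot_i d^+_j(\beta).$$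 \textbf{Theorem.} Let $C$ be a finitely $2$-decomposable local $n$-catoid of finite valency and $S$ an $n$-semiring. For a proposition $P$ let $[P]_i$ be $1_i\in S$ if $P$ holds and $0$ otherwise. For $f,g:C\to S$, $x\in C$ and $0\le i<n$ put $$(f*_i g)(x)=\sum_{y,z\in C}f(y)\cdot_i g(z)\cdot_i[x\in y\odot_i z]_i,\qquad \mathit{id}_i(x)=[s_i(x)=x]_i,$$ $$D^-_i(f)(x)=\sum_{y\in C}d^-_i(f(y))\cdot_i[x=s_i(y)]_i,\qquad D^+_i(f)(x)=\sum_{y\in C}d^+_i(f(y))\cdot_i[x=t_i(y)]_i.$$ Then all these sums have only finitely many nonzero summands, and the set $S^C$ of all functions $C\to S$, with pointwise addition and zero, forms an $n$-semiring $(S^C,+,0,*_i,\mathit{id}_i,D^-_i,D^+_i)_{0\le i<n}$; in particular it satisfies the closure axioms (the last displayed axioms of an $n$-semiring). -/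

import Mathlib

/-- A catoid `(C, ⊙, s, t)`: a set with a multioperation `⊙ : C × C → 𝒫 C` and source and target
maps. -/
structure Catoid (C : Type*) where
  /-- the multioperation `⊙` -/
  comp : C → C → Set C
  /-- the source map `s` -/
  src : C → C
  /-- the target map `t` -/
  tgt : C → C
  assoc : ∀ x y z : C, (⋃ v ∈ comp y z, comp x v) = ⋃ u ∈ comp x y, comp u z
  tgt_eq_src : ∀ x y : C, (comp x y).Nonempty → tgt x = src y
  src_comp : ∀ x : C, comp (src x) x = {x}
  comp_tgt : ∀ x : C, comp x (tgt x) = {x}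

namespace Catoid

variable {C : Type*} (K : Catoid C)

/-- The extension of `⊙` to subsets: `X ⊙ Y = ⋃ x ∈ X, y ∈ Y, x ⊙ y`. -/
def setComp (X Y : Set C) : Set C := ⋃ x ∈ X, ⋃ y ∈ Y, K.comp x y

/-- The set `C₀` of identities: the fixpoints of the source map (equivalently, of the target
map). -/
def identities : Set C := {x | K.src x = x}

/-- `x` and `y` are composable whenever the target of `x` is the source of `y`. -/
def IsLocal : Prop := ∀ x y : C, K.tgt x = K.src y → (K.comp x y).Nonempty

/-- The `2`-decompositions of `x`: pairs of non-identity elements whose composite contains `x`. -/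
def twoDecompositions (x : C) : Set (C × C) :=
  {p | p.1 ∉ K.identities ∧ p.2 ∉ K.identities ∧ x ∈ K.comp p.1 p.2}

/-- Every element has only finitely many `2`-decompositions. -/
def FinitelyTwoDecomposable : Prop := ∀ x : C, (K.twoDecompositions x).Finite

/-- Every identity is the source of only finitely many elements, and the target of only finitely
many elements. -/
def FiniteValency : Prop :=
  ∀ e ∈ K.identities, {x | K.src x = e}.Finite ∧ {x | K.tgt x = e}.Finite

end Catoid

/-- An `n`-catoid: `n` catoid structures on one set, with the compatibility axioms, including the
closure axioms for sources and targets. -/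
structure NCatoid (n : ℕ) (C : Type*) where
  /-- the catoid in dimension `i` -/
  cat : Fin n → Catoid C
  src_src : ∀ i j, i ≠ j → ∀ x, (cat i).src ((cat j).src x) = (cat j).src ((cat i).src x)
  src_tgt : ∀ i j, i ≠ j → ∀ x, (cat i).src ((cat j).tgt x) = (cat j).tgt ((cat i).src x)
  tgt_src : ∀ i j, i ≠ j → ∀ x, (cat i).tgt ((cat j).src x) = (cat j).src ((cat i).tgt x)
  tgt_tgt : ∀ i j, i ≠ j → ∀ x, (cat i).tgt ((cat j).tgt x) = (cat j).tgt ((cat i).tgt x)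
  src_comp_subset : ∀ i j, i ≠ j → ∀ x y,
    (cat i).src '' (cat j).comp x y ⊆ (cat j).comp ((cat i).src x) ((cat i).src y)
  tgt_comp_subset : ∀ i j, i ≠ j → ∀ x y,
    (cat i).tgt '' (cat j).comp x y ⊆ (cat j).comp ((cat i).tgt x) ((cat i).tgt y)
  interchange : ∀ i j, i < j → ∀ w x y z,
    (cat i).setComp ((cat j).comp w x) ((cat j).comp y z) ⊆
      (cat j).setComp ((cat i).comp w y) ((cat i).comp x z)
  src_src_of_lt : ∀ i j, i < j → ∀ x, (cat j).src ((cat i).src x) = (cat i).src x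
  src_tgt_of_lt : ∀ i j, i < j → ∀ x, (cat j).src ((cat i).tgt x) = (cat i).tgt x
  tgt_src_of_lt : ∀ i j, i < j → ∀ x, (cat j).tgt ((cat i).src x) = (cat i).src x
  tgt_tgt_of_lt : ∀ i j, i < j → ∀ x, (cat j).tgt ((cat i).tgt x) = (cat i).tgt x
  src_closure : ∀ i j, i < j → ∀ x y,
    (cat j).src '' (cat i).comp ((cat j).src x) ((cat j).src y) =
      (cat i).comp ((cat j).src x) ((cat j).src y)
  tgt_closure : ∀ i j, i < j → ∀ x y,
    (cat j).tgt '' (cat i).comp ((cat j).tgt x) ((cat j).tgt y) =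
      (cat i).comp ((cat j).tgt x) ((cat j).tgt y)

namespace NCatoid

variable {n : ℕ} {C : Type*} (K : NCatoid n C)

/-- Local in each dimension. -/
def IsLocal : Prop := ∀ i, (K.cat i).IsLocal

/-- Finitely `2`-decomposable in each dimension. -/
def FinitelyTwoDecomposable : Prop := ∀ i, (K.cat i).FinitelyTwoDecomposable

/-- Of finite valency in each dimension. -/
def FiniteValency : Prop := ∀ i, (K.cat i).FiniteValency

end NCatoid

/-- The order of an additively idempotent semiring: `α ≤ β` iff `α + β = β`. -/
def AddLE {S : Type*} [AddCommMonoid S] (α β : S) : Prop := α + β = β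

/-- `(S, +, 0, mul, one)` is a dioid, that is, an additively idempotent semiring. That `(S, +, 0)`
is a commutative monoid is part of the instance. -/
structure IsDioid {S : Type*} [AddCommMonoid S] (mul : S → S → S) (one : S) : Prop where
  mul_assoc : ∀ α β γ, mul (mul α β) γ = mul α (mul β γ)
  one_mul : ∀ α, mul one α = α
  mul_one : ∀ α, mul α one = α
  left_distrib : ∀ α β γ, mul α (β + γ) = mul α β + mul α γ
  right_distrib : ∀ α β γ, mul (α + β) γ = mul α γ + mul β γ
  zero_mul : ∀ α, mul 0 α = 0
  mul_zero : ∀ α, mul α 0 = 0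
  add_idem : ∀ α : S, α + α = α

/-- `(S, +, 0, mul, one, dom, cod)` is a modal semiring, with domain map `dom` (written `d⁻`) and
codomain map `cod` (written `d⁺`). -/
structure IsModalSemiring {S : Type*} [AddCommMonoid S] (mul : S → S → S) (one : S)
    (dom cod : S → S) : Prop where
  isDioid : IsDioid mul one
  le_dom_mul : ∀ α, AddLE α (mul (dom α) α)
  dom_mul_dom : ∀ α β, dom (mul α (dom β)) = dom (mul α β)
  dom_le_one : ∀ α, AddLE (dom α) one
  dom_zero : dom 0 = 0
  dom_add : ∀ α β, dom (α + β) = dom α + dom β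
  le_mul_cod : ∀ α, AddLE α (mul α (cod α))
  cod_cod_mul : ∀ α β, cod (mul (cod α) β) = cod (mul α β)
  cod_le_one : ∀ α, AddLE (cod α) one
  cod_zero : cod 0 = 0
  cod_add : ∀ α β, cod (α + β) = cod α + cod β
  cod_dom : ∀ α, cod (dom α) = dom α
  dom_cod : ∀ α, dom (cod α) = cod α

/-- The operations of an `n`-semiring, besides `+` and `0`, for each dimension `i < n`. -/
structure NSemiringOps (n : ℕ) (S : Type*) where
  /-- the multiplication `·ᵢ` -/
  mul : Fin n → S → S → S
  /-- the unit `1ᵢ` -/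
  one : Fin n → S
  /-- the domain map `d⁻ᵢ` -/
  dom : Fin n → S → S
  /-- the codomain map `d⁺ᵢ` -/
  cod : Fin n → S → S

/-- The operations `A`, together with `+` and `0`, form an `n`-semiring; the closure axioms for
domain and codomain are included. -/
structure IsNSemiring {n : ℕ} {S : Type*} [AddCommMonoid S] (A : NSemiringOps n S) : Prop where
  isModalSemiring : ∀ i, IsModalSemiring (A.mul i) (A.one i) (A.dom i) (A.cod i)
  dom_mul_le : ∀ i j, i ≠ j → ∀ α β,
    AddLE (A.dom i (A.mul j α β)) (A.mul j (A.dom i α) (A.dom i β))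
  cod_mul_le : ∀ i j, i ≠ j → ∀ α β,
    AddLE (A.cod i (A.mul j α β)) (A.mul j (A.cod i α) (A.cod i β))
  interchange : ∀ i j, i < j → ∀ α β γ δ,
    AddLE (A.mul i (A.mul j α β) (A.mul j γ δ)) (A.mul j (A.mul i α γ) (A.mul i β δ))
  dom_dom : ∀ i j, i < j → ∀ α, A.dom j (A.dom i α) = A.dom i α
  dom_closure : ∀ i j, i < j → ∀ α β,
    A.dom j (A.mul i (A.dom j α) (A.dom j β)) = A.mul i (A.dom j α) (A.dom j β)
  cod_closure : ∀ i j, i < j → ∀ α β,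
    A.cod j (A.mul i (A.cod j α) (A.cod j β)) = A.mul i (A.cod j α) (A.cod j β)

open Classical in
/-- The indicator `[P]`, with value the given unit if `P` holds and `0` otherwise. -/
noncomputable def indicatorOf {S : Type*} [AddCommMonoid S] (one : S) (P : Prop) : S :=
  if P then one else 0

section Convolution

variable {n : ℕ} {C S : Type*} [AddCommMonoid S] (K : NCatoid n C) (A : NSemiringOps n S)

/-- The summand `f(y) ·ᵢ g(z) ·ᵢ [x ∈ y ⊙ᵢ z]` of the `i`-th convolution, for `p = (y, z)`. -/
noncomputable def convTerm (i : Fin n) (f g : C → S) (x : C) (p : C × C) : S :=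
  A.mul i (A.mul i (f p.1) (g p.2)) (indicatorOf (A.one i) (x ∈ (K.cat i).comp p.1 p.2))

/-- The summand `d⁻ᵢ(f(y)) ·ᵢ [x = sᵢ(y)]` of the `i`-th domain map. -/
noncomputable def domTerm (i : Fin n) (f : C → S) (x y : C) : S :=
  A.mul i (A.dom i (f y)) (indicatorOf (A.one i) (x = (K.cat i).src y))

/-- The summand `d⁺ᵢ(f(y)) ·ᵢ [x = tᵢ(y)]` of the `i`-th codomain map. -/
noncomputable def codTerm (i : Fin n) (f : C → S) (x y : C) : S :=
  A.mul i (A.cod i (f y)) (indicatorOf (A.one i) (x = (K.cat i).tgt y))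

/-- The operations on `S^C`: convolutions, indicator functions of the identities, and the maps
`D⁻ᵢ` and `D⁺ᵢ`. Addition and zero on `C → S` are pointwise. -/
noncomputable def convolutionOps : NSemiringOps n (C → S) where
  mul i f g x := ∑ᶠ p : C × C, convTerm K A i f g x p
  one i x := indicatorOf (A.one i) (x ∈ (K.cat i).identities)
  dom i f x := ∑ᶠ y : C, domTerm K A i f x y
  cod i f x := ∑ᶠ y : C, codTerm K A i f x y

end Convolution

/-! Since addition is idempotent, a finite sum in `S` is the least upper bound of its summands: it
lies below `c` iff every summand does. Finite `2`-decomposability and finite valency make the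
supports finite, so the `finsum`s are genuine sums and not the default `0`. Hence a value of a
convolution, of `D⁻ᵢ` or of `D⁺ᵢ` lies below `c` iff a condition holds for all decompositions, or
all elements with the given source or target; the indicators become hypotheses.

Multiplication by a fixed element, domain and codomain are additive, so they commute with finite
sums and nested expressions unfold in the same way. This is why the bounds below carry an arbitrary
`φ : S →+ S`.

An equation or inequality in `S^C` is then checked pointwise by comparing upper bounds. What remains
pairs a catoid axiom, which turns decompositions for one side into decompositions for the other,
with the same axiom of `S`, which compares the summands. Locality enters in `D⁻(f * D⁻ g) ≤ D⁻(f *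
g)` and its dual, where a composite has to be produced from matching endpoints alone. -/

section Order

/-! ### Finite sums as suprema in an idempotent monoid. -/

variable {S : Type*} [AddCommMonoid S]

namespace AddLE

variable {a b c : S}

theorem trans (hab : AddLE a b) (hbc : AddLE b c) : AddLE a c := by
  unfold AddLE at *
  rw [← hbc, ← add_assoc, hab]

theorem antisymm (hab : AddLE a b) (hba : AddLE b a) : a = b := by
  unfold AddLE at *
  rw [← hba, add_comm, hab]

theorem zero_le (a : S) : AddLE 0 a := zero_add a

theorem of_eq_of_addLE (hab : a = b) (hbc : AddLE b c) : AddLE a c := hab ▸ hbc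

theorem map (φ : S →+ S) (h : AddLE a b) : AddLE (φ a) (φ b) := by
  unfold AddLE at *
  rw [← map_add, h]

theorem pi_iff {C : Type*} {f g : C → S} : AddLE f g ↔ ∀ x, AddLE (f x) (g x) := funext_iff

end AddLE

theorem add_addLE_iff (hid : ∀ a : S, a + a = a) {a b c : S} :
    AddLE (a + b) c ↔ AddLE a c ∧ AddLE b c := by
  constructor
  · intro h
    refine ⟨AddLE.trans ?_ h, AddLE.trans ?_ h⟩
    · unfold AddLE
      rw [← add_assoc, hid]
    · unfold AddLE
      rw [add_left_comm, hid]
  · rintro ⟨h₁, h₂⟩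
    unfold AddLE at *
    rw [add_assoc, h₂, h₁]

/-- Idempotence is reflexivity of `AddLE`, so an element is determined by its upper bounds. This
reduces equations in `S^C` to equivalences between families of bounds. -/
theorem eq_of_forall_addLE_iff (hid : ∀ a : S, a + a = a) {a b : S}
    (h : ∀ c, AddLE a c ↔ AddLE b c) : a = b :=
  AddLE.antisymm ((h b).2 (hid b)) ((h a).1 (hid a))

theorem addLE_of_forall (hid : ∀ a : S, a + a = a) {a b : S}
    (h : ∀ c, AddLE b c → AddLE a c) : AddLE a b := h b (hid b)

theorem sum_addLE_iff (hid : ∀ a : S, a + a = a) {ι : Type*} (s : Finset ι) (t : ι → S) {c : S} :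
    AddLE (∑ i ∈ s, t i) c ↔ ∀ i ∈ s, AddLE (t i) c := by
  classical
  induction s using Finset.induction_on with
  | empty => simp [AddLE.zero_le]
  | insert i s hi ih => rw [Finset.sum_insert hi, add_addLE_iff hid, ih, Finset.forall_mem_insert]

/-- The image of the sum is the supremum of the images; indices outside the support contribute `φ 0
= 0`, which is below everything. -/
theorem map_finsum_addLE_iff (hid : ∀ a : S, a + a = a) (φ : S →+ S) {ι : Type*} {t : ι → S}
    (ht : (Function.support t).Finite) {c : S} :
    AddLE (φ (∑ᶠ i, t i)) c ↔ ∀ i, AddLE (φ (t i)) c := by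
  rw [finsum_eq_sum t ht, map_sum, sum_addLE_iff hid]
  refine ⟨fun h i => ?_, fun h i _ => h i⟩
  by_cases hi : t i = 0
  · rw [hi, map_zero]
    exact AddLE.zero_le c
  · exact h i (by simpa using hi)

theorem map_indicatorOf_addLE_iff (φ : S →+ S) {one c : S} {P : Prop} :
    AddLE (φ (indicatorOf one P)) c ↔ (P → AddLE (φ one) c) := by
  unfold indicatorOf
  split_ifs with h
  · simp [h]
  · simp [h, AddLE.zero_le]

end Order

/-! ### Semiring operations as additive maps. -/

section Homs

variable {S : Type*} [AddCommMonoid S] {mul : S → S → S} {one : S} {dom cod : S → S}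

namespace IsDioid

/-- Left multiplication by `a`, as an additive map. -/
def mulLeft (h : IsDioid mul one) (a : S) : S →+ S where
  toFun := mul a
  map_zero' := h.mul_zero a
  map_add' := h.left_distrib a

/-- Right multiplication by `a`, as an additive map. -/
def mulRight (h : IsDioid mul one) (a : S) : S →+ S where
  toFun b := mul b a
  map_zero' := h.zero_mul a
  map_add' b c := h.right_distrib b c a

theorem mul_indicatorOf_eq_zero (h : IsDioid mul one) {P : Prop} (hP : ¬P) (a : S) :
    mul a (indicatorOf one P) = 0 := by
  rw [indicatorOf, if_neg hP, h.mul_zero]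

end IsDioid

namespace IsModalSemiring

/-- The domain map, as an additive map. -/
def domHom (h : IsModalSemiring mul one dom cod) : S →+ S where
  toFun := dom
  map_zero' := h.dom_zero
  map_add' := h.dom_add

/-- The codomain map, as an additive map. -/
def codHom (h : IsModalSemiring mul one dom cod) : S →+ S where
  toFun := cod
  map_zero' := h.cod_zero
  map_add' := h.cod_add

end IsModalSemiring

end Homs

/-! ### Sources, targets and finiteness in a single catoid. -/

namespace Catoid

variable {C : Type*} (K : Catoid C)

theorem tgt_src (x : C) : K.tgt (K.src x) = K.src x := by
  have h : x ∈ K.comp (K.src x) x := by simp [K.src_comp]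
  exact K.tgt_eq_src _ _ ⟨x, h⟩

theorem src_tgt (x : C) : K.src (K.tgt x) = K.tgt x := by
  have h : x ∈ K.comp x (K.tgt x) := by simp [K.comp_tgt]
  exact (K.tgt_eq_src _ _ ⟨x, h⟩).symm

theorem src_src (x : C) : K.src (K.src x) = K.src x := by
  rw [← K.tgt_src x, K.src_tgt]

theorem tgt_tgt (x : C) : K.tgt (K.tgt x) = K.tgt x := by
  rw [← K.src_tgt x, K.tgt_src]

variable {K}

theorem mem_identities_src (x : C) : K.src x ∈ K.identities := K.src_src x

theorem mem_identities_tgt (x : C) : K.tgt x ∈ K.identities := K.src_tgt x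

theorem tgt_of_mem_identities {e : C} (he : e ∈ K.identities) : K.tgt e = e := by
  have he : K.src e = e := he
  rw [← he, K.tgt_src]

theorem tgt_eq_src_of_mem_comp {x y z : C} (h : x ∈ K.comp y z) : K.tgt y = K.src z :=
  K.tgt_eq_src y z ⟨x, h⟩

theorem mem_comp_src (x : C) : x ∈ K.comp (K.src x) x := by simp [K.src_comp]

theorem mem_comp_tgt (x : C) : x ∈ K.comp x (K.tgt x) := by simp [K.comp_tgt]

theorem eq_of_mem_comp_left {x e z : C} (he : e ∈ K.identities) (h : x ∈ K.comp e z) :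
    e = K.src z ∧ x = z := by
  have h₁ : e = K.src z := by rw [← tgt_eq_src_of_mem_comp h, tgt_of_mem_identities he]
  refine ⟨h₁, ?_⟩
  rwa [h₁, K.src_comp] at h

theorem eq_of_mem_comp_right {x y e : C} (he : e ∈ K.identities) (h : x ∈ K.comp y e) :
    e = K.tgt y ∧ x = y := by
  have h₁ : e = K.tgt y := by rw [tgt_eq_src_of_mem_comp h]; exact he.symm
  refine ⟨h₁, ?_⟩
  rwa [h₁, K.comp_tgt] at h

theorem exists_mem_comp_assoc {w x y z : C} :
    (∃ v ∈ K.comp y z, w ∈ K.comp x v) ↔ ∃ u ∈ K.comp x y, w ∈ K.comp u z := by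
  have := Set.ext_iff.1 (K.assoc x y z) w
  simpa only [Set.mem_iUnion, exists_prop] using this

/-- Reassociating `x ∈ s(x) ⊙ (y ⊙ z)` gives an element of `s(x) ⊙ y`, so `t(s(x)) = s(y)`, and
`t(s(x)) = s(x)`. -/
theorem src_of_mem_comp {x y z : C} (h : x ∈ K.comp y z) : K.src x = K.src y := by
  obtain ⟨u, hu, hx⟩ := exists_mem_comp_assoc.1 ⟨x, h, mem_comp_src x⟩
  rw [← tgt_eq_src_of_mem_comp hu, K.tgt_src]

theorem tgt_of_mem_comp {x y z : C} (h : x ∈ K.comp y z) : K.tgt x = K.tgt z := by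
  obtain ⟨v, hv, hx⟩ := exists_mem_comp_assoc.2 ⟨x, h, mem_comp_tgt x⟩
  rw [tgt_eq_src_of_mem_comp hv, K.src_tgt]

/-- By the unit laws, allowing identities as factors adds at most the two decompositions `(s(x), x)`
and `(x, t(x))`. -/
theorem FinitelyTwoDecomposable.finite_decompositions (h : K.FinitelyTwoDecomposable) (x : C) :
    {p : C × C | x ∈ K.comp p.1 p.2}.Finite := by
  refine ((h x).union (Set.toFinite {(K.src x, x), (x, K.tgt x)})).subset ?_
  rintro ⟨y, z⟩ hx
  change x ∈ K.comp y z at hx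
  by_cases hy : y ∈ K.identities
  · obtain ⟨rfl, rfl⟩ := eq_of_mem_comp_left hy hx
    simp
  by_cases hz : z ∈ K.identities
  · obtain ⟨rfl, rfl⟩ := eq_of_mem_comp_right hz hx
    simp
  exact Or.inl ⟨hy, hz, hx⟩

/-- Finite valency concerns identities only, but every source is an identity, so the fibre over any
other element is empty. -/
theorem FiniteValency.finite_src (h : K.FiniteValency) (x : C) : {y | x = K.src y}.Finite := by
  by_cases hx : x ∈ K.identities
  · simpa only [eq_comm] using (h x hx).1
  · refine Set.finite_empty.subset ?_
    rintro y rfl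
    exact hx (mem_identities_src y)

theorem FiniteValency.finite_tgt (h : K.FiniteValency) (x : C) : {y | x = K.tgt y}.Finite := by
  by_cases hx : x ∈ K.identities
  · simpa only [eq_comm] using (h x hx).2
  · refine Set.finite_empty.subset ?_
    rintro y rfl
    exact hx (mem_identities_tgt y)

end Catoid

/-! ### Upper bounds of convolutions, domains and codomains. -/

section Convolution

variable {n : ℕ} {C S : Type*} [AddCommMonoid S] {K : NCatoid n C} {A : NSemiringOps n S}

theorem IsNSemiring.isDioid (hA : IsNSemiring A) (i : Fin n) : IsDioid (A.mul i) (A.one i) :=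
  (hA.isModalSemiring i).isDioid

theorem finite_support_convTerm (hA : IsNSemiring A) (hdec : K.FinitelyTwoDecomposable)
    (i : Fin n) (f g : C → S) (x : C) : (Function.support (convTerm K A i f g x)).Finite := by
  refine ((hdec i).finite_decompositions x).subset fun p hp => ?_
  by_contra h
  exact hp ((hA.isDioid i).mul_indicatorOf_eq_zero h _)

theorem finite_support_domTerm (hA : IsNSemiring A) (hval : K.FiniteValency)
    (i : Fin n) (f : C → S) (x : C) : (Function.support (domTerm K A i f x)).Finite := by
  refine ((hval i).finite_src x).subset fun p hp => ?_
  by_contra h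
  exact hp ((hA.isDioid i).mul_indicatorOf_eq_zero h _)

theorem finite_support_codTerm (hA : IsNSemiring A) (hval : K.FiniteValency)
    (i : Fin n) (f : C → S) (x : C) : (Function.support (codTerm K A i f x)).Finite := by
  refine ((hval i).finite_tgt x).subset fun p hp => ?_
  by_contra h
  exact hp ((hA.isDioid i).mul_indicatorOf_eq_zero h _)

/-- The product is `a` or `0` according to `P`, and `0` satisfies every bound; so an indicator
factor amounts to a hypothesis. -/
theorem IsNSemiring.map_mul_indicatorOf_addLE_iff (hA : IsNSemiring A) (φ : S →+ S) (i : Fin n)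
    {a c : S} {P : Prop} :
    AddLE (φ (A.mul i a (indicatorOf (A.one i) P))) c ↔ (P → AddLE (φ a) c) := by
  have h := map_indicatorOf_addLE_iff (φ.comp ((hA.isDioid i).mulLeft a)) (one := A.one i)
    (P := P) (c := c)
  simpa only [AddMonoidHom.comp_apply, IsDioid.mulLeft, AddMonoidHom.coe_mk, ZeroHom.coe_mk,
    (hA.isDioid i).mul_one] using h

theorem map_convolution_addLE_iff (hA : IsNSemiring A) (hdec : K.FinitelyTwoDecomposable)
    (φ : S →+ S) {i : Fin n} {f g : C → S} {x : C} {c : S} :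
    AddLE (φ ((convolutionOps K A).mul i f g x)) c ↔
      ∀ y z, x ∈ (K.cat i).comp y z → AddLE (φ (A.mul i (f y) (g z))) c := by
  refine (map_finsum_addLE_iff (hA.isDioid i).add_idem φ
    (finite_support_convTerm hA hdec i f g x)).trans ?_
  rw [Prod.forall]
  exact forall₂_congr fun y z => hA.map_mul_indicatorOf_addLE_iff φ i

theorem map_dom_addLE_iff (hA : IsNSemiring A) (hval : K.FiniteValency)
    (φ : S →+ S) {i : Fin n} {f : C → S} {x : C} {c : S} :
    AddLE (φ ((convolutionOps K A).dom i f x)) c ↔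
      ∀ y, x = (K.cat i).src y → AddLE (φ (A.dom i (f y))) c :=
  (map_finsum_addLE_iff (hA.isDioid i).add_idem φ (finite_support_domTerm hA hval i f x)).trans
    (forall_congr' fun _ => hA.map_mul_indicatorOf_addLE_iff φ i)

theorem map_cod_addLE_iff (hA : IsNSemiring A) (hval : K.FiniteValency)
    (φ : S →+ S) {i : Fin n} {f : C → S} {x : C} {c : S} :
    AddLE (φ ((convolutionOps K A).cod i f x)) c ↔
      ∀ y, x = (K.cat i).tgt y → AddLE (φ (A.cod i (f y))) c :=
  (map_finsum_addLE_iff (hA.isDioid i).add_idem φ (finite_support_codTerm hA hval i f x)).trans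
    (forall_congr' fun _ => hA.map_mul_indicatorOf_addLE_iff φ i)

theorem convolution_addLE_iff (hA : IsNSemiring A) (hdec : K.FinitelyTwoDecomposable)
    {i : Fin n} {f g : C → S} {x : C} {c : S} :
    AddLE ((convolutionOps K A).mul i f g x) c ↔
      ∀ y z, x ∈ (K.cat i).comp y z → AddLE (A.mul i (f y) (g z)) c :=
  map_convolution_addLE_iff hA hdec (AddMonoidHom.id S)

theorem dom_addLE_iff (hA : IsNSemiring A) (hval : K.FiniteValency)
    {i : Fin n} {f : C → S} {x : C} {c : S} :
    AddLE ((convolutionOps K A).dom i f x) c ↔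
      ∀ y, x = (K.cat i).src y → AddLE (A.dom i (f y)) c :=
  map_dom_addLE_iff hA hval (AddMonoidHom.id S)

theorem cod_addLE_iff (hA : IsNSemiring A) (hval : K.FiniteValency)
    {i : Fin n} {f : C → S} {x : C} {c : S} :
    AddLE ((convolutionOps K A).cod i f x) c ↔
      ∀ y, x = (K.cat i).tgt y → AddLE (A.cod i (f y)) c :=
  map_cod_addLE_iff hA hval (AddMonoidHom.id S)

/-- The two factors are expanded in turn, with `φ` a right and then a left multiplication by the
factor held fixed. -/
theorem mul_convolution_convolution_addLE_iff (hA : IsNSemiring A)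
    (hdec : K.FinitelyTwoDecomposable) {i j : Fin n} {f g h k : C → S} {u v : C} {c : S} :
    AddLE (A.mul i ((convolutionOps K A).mul j f g u) ((convolutionOps K A).mul j h k v)) c ↔
      ∀ y z, u ∈ (K.cat j).comp y z → ∀ y' z', v ∈ (K.cat j).comp y' z' →
        AddLE (A.mul i (A.mul j (f y) (g z)) (A.mul j (h y') (k z'))) c := by
  refine (map_convolution_addLE_iff hA hdec ((hA.isDioid i).mulRight _)).trans ?_
  exact forall₃_congr fun y z _ => map_convolution_addLE_iff hA hdec ((hA.isDioid i).mulLeft _)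

theorem mul_dom_dom_addLE_iff (hA : IsNSemiring A) (hval : K.FiniteValency)
    (φ : S →+ S) {i j : Fin n} {f g : C → S} {u v : C} {c : S} :
    AddLE (φ (A.mul i ((convolutionOps K A).dom j f u) ((convolutionOps K A).dom j g v))) c ↔
      ∀ y, u = (K.cat j).src y → ∀ z, v = (K.cat j).src z →
        AddLE (φ (A.mul i (A.dom j (f y)) (A.dom j (g z)))) c := by
  refine (map_dom_addLE_iff hA hval (φ.comp ((hA.isDioid i).mulRight _))).trans ?_
  exact forall₂_congr fun y _ =>
    map_dom_addLE_iff hA hval (φ.comp ((hA.isDioid i).mulLeft _))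

theorem mul_cod_cod_addLE_iff (hA : IsNSemiring A) (hval : K.FiniteValency)
    (φ : S →+ S) {i j : Fin n} {f g : C → S} {u v : C} {c : S} :
    AddLE (φ (A.mul i ((convolutionOps K A).cod j f u) ((convolutionOps K A).cod j g v))) c ↔
      ∀ y, u = (K.cat j).tgt y → ∀ z, v = (K.cat j).tgt z →
        AddLE (φ (A.mul i (A.cod j (f y)) (A.cod j (g z)))) c := by
  refine (map_cod_addLE_iff hA hval (φ.comp ((hA.isDioid i).mulRight _))).trans ?_
  exact forall₂_congr fun y _ =>
    map_cod_addLE_iff hA hval (φ.comp ((hA.isDioid i).mulLeft _))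

/-! ### The convolution dioid in one dimension. -/

theorem isDioid_convolution (hA : IsNSemiring A) (hdec : K.FinitelyTwoDecomposable) (i : Fin n) :
    IsDioid ((convolutionOps K A).mul i) ((convolutionOps K A).one i) where
  mul_assoc f g h := by
    have hD := hA.isDioid i
    funext x
    refine eq_of_forall_addLE_iff hD.add_idem fun c => ?_
    rw [convolution_addLE_iff hA hdec, convolution_addLE_iff hA hdec]
    constructor
    · intro H y v hx
      refine (map_convolution_addLE_iff hA hdec (hD.mulLeft _)).2 fun z w hv => ?_
      obtain ⟨u, hu, hx⟩ := Catoid.exists_mem_comp_assoc.1 ⟨v, hv, hx⟩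
      have := (map_convolution_addLE_iff hA hdec (hD.mulRight _)).1 (H u w hx) y z hu
      exact AddLE.of_eq_of_addLE (hD.mul_assoc _ _ _).symm this
    · intro H u w hx
      refine (map_convolution_addLE_iff hA hdec (hD.mulRight _)).2 fun y z hu => ?_
      obtain ⟨v, hv, hx⟩ := Catoid.exists_mem_comp_assoc.2 ⟨u, hu, hx⟩
      have := (map_convolution_addLE_iff hA hdec (hD.mulLeft _)).1 (H y v hx) z w hv
      exact AddLE.of_eq_of_addLE (hD.mul_assoc _ _ _) this
  one_mul f := by
    have hD := hA.isDioid i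
    funext x
    refine eq_of_forall_addLE_iff hD.add_idem fun c => ?_
    rw [convolution_addLE_iff hA hdec]
    constructor
    · intro H
      -- The decomposition `x ∈ s(x) ⊙ x` attains the value `f x`; by the unit law no other one has
      -- an identity on the left.
      have := (map_indicatorOf_addLE_iff (hD.mulRight _)).1 (H _ _ (Catoid.mem_comp_src x))
        (Catoid.mem_identities_src x)
      exact AddLE.of_eq_of_addLE (hD.one_mul _).symm this
    · intro H y z hx
      refine (map_indicatorOf_addLE_iff (hD.mulRight _)).2 fun hy => ?_
      obtain ⟨-, rfl⟩ := Catoid.eq_of_mem_comp_left hy hx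
      exact AddLE.of_eq_of_addLE (hD.one_mul _) H
  mul_one f := by
    have hD := hA.isDioid i
    funext x
    refine eq_of_forall_addLE_iff hD.add_idem fun c => ?_
    rw [convolution_addLE_iff hA hdec]
    constructor
    · intro H
      have := (map_indicatorOf_addLE_iff (hD.mulLeft _)).1 (H _ _ (Catoid.mem_comp_tgt x))
        (Catoid.mem_identities_tgt x)
      exact AddLE.of_eq_of_addLE (hD.mul_one _).symm this
    · intro H y z hx
      refine (map_indicatorOf_addLE_iff (hD.mulLeft _)).2 fun hz => ?_
      obtain ⟨-, rfl⟩ := Catoid.eq_of_mem_comp_right hz hx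
      exact AddLE.of_eq_of_addLE (hD.mul_one _) H
  left_distrib f g h := by
    have hD := hA.isDioid i
    funext x
    refine eq_of_forall_addLE_iff hD.add_idem fun c => ?_
    rw [Pi.add_apply, add_addLE_iff hD.add_idem, convolution_addLE_iff hA hdec,
      convolution_addLE_iff hA hdec, convolution_addLE_iff hA hdec]
    simp only [Pi.add_apply, hD.left_distrib, add_addLE_iff hD.add_idem, imp_and, forall_and]
  right_distrib f g h := by
    have hD := hA.isDioid i
    funext x
    refine eq_of_forall_addLE_iff hD.add_idem fun c => ?_
    rw [Pi.add_apply, add_addLE_iff hD.add_idem, convolution_addLE_iff hA hdec,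
      convolution_addLE_iff hA hdec, convolution_addLE_iff hA hdec]
    simp only [Pi.add_apply, hD.right_distrib, add_addLE_iff hD.add_idem, imp_and, forall_and]
  zero_mul f := by
    funext x
    refine eq_of_forall_addLE_iff (hA.isDioid i).add_idem fun c => ?_
    simp only [convolution_addLE_iff hA hdec, Pi.zero_apply, (hA.isDioid i).zero_mul,
      AddLE.zero_le, implies_true]
  mul_zero f := by
    funext x
    refine eq_of_forall_addLE_iff (hA.isDioid i).add_idem fun c => ?_
    simp only [convolution_addLE_iff hA hdec, Pi.zero_apply, (hA.isDioid i).mul_zero,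
      AddLE.zero_le, implies_true]
  add_idem f := funext fun x => (hA.isDioid i).add_idem (f x)

/-! ### The modal axioms in one dimension. -/

theorem isModalSemiring_convolution (hA : IsNSemiring A) (hdec : K.FinitelyTwoDecomposable)
    (hloc : K.IsLocal) (hval : K.FiniteValency) (i : Fin n) :
    IsModalSemiring ((convolutionOps K A).mul i) ((convolutionOps K A).one i)
      ((convolutionOps K A).dom i) ((convolutionOps K A).cod i) where
  isDioid := isDioid_convolution hA hdec i
  le_dom_mul f := AddLE.pi_iff.2 fun x => by
    have hD := hA.isDioid i
    refine addLE_of_forall hD.add_idem fun c hc => ?_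
    have h := (convolution_addLE_iff hA hdec).1 hc _ _ (Catoid.mem_comp_src x)
    have h := (map_dom_addLE_iff hA hval (hD.mulRight _)).1 h x rfl
    exact ((hA.isModalSemiring i).le_dom_mul _).trans h
  dom_mul_dom f g := by
    have hM := hA.isModalSemiring i
    have hD := hA.isDioid i
    funext x
    refine eq_of_forall_addLE_iff hD.add_idem fun c => ?_
    rw [dom_addLE_iff hA hval, dom_addLE_iff hA hval]
    constructor
    · rintro H w rfl
      refine (map_convolution_addLE_iff hA hdec hM.domHom).2 fun u a hw => ?_
      -- The pair `(u, a)` is replaced by `(u, s(a))`: as `s(a) = t(u)`, the composite is `u`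
      -- itself, which has the same source as `w`.
      have hu : u ∈ (K.cat i).comp u ((K.cat i).src a) := by
        rw [← Catoid.tgt_eq_src_of_mem_comp hw]
        exact Catoid.mem_comp_tgt u
      have h := (map_convolution_addLE_iff hA hdec hM.domHom).1
        (H u (Catoid.src_of_mem_comp hw)) _ _ hu
      have h := (map_dom_addLE_iff hA hval (hM.domHom.comp (hD.mulLeft _))).1 h a rfl
      exact AddLE.of_eq_of_addLE (hM.dom_mul_dom _ _).symm h
    · rintro H w rfl
      refine (map_convolution_addLE_iff hA hdec hM.domHom).2 fun u v hw => ?_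
      refine (map_dom_addLE_iff hA hval (hM.domHom.comp (hD.mulLeft _))).2 ?_
      rintro a rfl
      -- Only `u` and `s(a)` are known to compose; locality makes `u` and `a` composable, and any
      -- composite `b` has source `s(u) = s(w)`.
      obtain ⟨b, hb⟩ := hloc i u a (by
        rw [Catoid.tgt_eq_src_of_mem_comp hw, Catoid.src_src])
      have h := (map_convolution_addLE_iff hA hdec hM.domHom).1 (H b (by
        rw [Catoid.src_of_mem_comp hw, Catoid.src_of_mem_comp hb])) u a hb
      exact AddLE.of_eq_of_addLE (hM.dom_mul_dom _ _) h
  dom_le_one f := AddLE.pi_iff.2 fun x => by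
    refine (dom_addLE_iff hA hval).2 ?_
    rintro y rfl
    change AddLE _ (indicatorOf _ _)
    rw [indicatorOf, if_pos (Catoid.mem_identities_src y)]
    exact (hA.isModalSemiring i).dom_le_one _
  dom_zero := by
    funext x
    refine eq_of_forall_addLE_iff (hA.isDioid i).add_idem fun c => ?_
    simp only [dom_addLE_iff hA hval, Pi.zero_apply, (hA.isModalSemiring i).dom_zero,
      AddLE.zero_le, implies_true]
  dom_add f g := by
    have hid := (hA.isDioid i).add_idem
    funext x
    refine eq_of_forall_addLE_iff hid fun c => ?_
    rw [Pi.add_apply, add_addLE_iff hid, dom_addLE_iff hA hval, dom_addLE_iff hA hval,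
      dom_addLE_iff hA hval]
    simp only [Pi.add_apply, (hA.isModalSemiring i).dom_add, add_addLE_iff hid, imp_and,
      forall_and]
  le_mul_cod f := AddLE.pi_iff.2 fun x => by
    have hD := hA.isDioid i
    refine addLE_of_forall hD.add_idem fun c hc => ?_
    have h := (convolution_addLE_iff hA hdec).1 hc _ _ (Catoid.mem_comp_tgt x)
    have h := (map_cod_addLE_iff hA hval (hD.mulLeft _)).1 h x rfl
    exact ((hA.isModalSemiring i).le_mul_cod _).trans h
  cod_cod_mul f g := by
    have hM := hA.isModalSemiring i
    have hD := hA.isDioid i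
    funext x
    refine eq_of_forall_addLE_iff hD.add_idem fun c => ?_
    rw [cod_addLE_iff hA hval, cod_addLE_iff hA hval]
    constructor
    · rintro H w rfl
      refine (map_convolution_addLE_iff hA hdec hM.codHom).2 fun a u hw => ?_
      have hu : u ∈ (K.cat i).comp ((K.cat i).tgt a) u := by
        rw [Catoid.tgt_eq_src_of_mem_comp hw]
        exact Catoid.mem_comp_src u
      have h := (map_convolution_addLE_iff hA hdec hM.codHom).1
        (H u (Catoid.tgt_of_mem_comp hw)) _ _ hu
      have h := (map_cod_addLE_iff hA hval (hM.codHom.comp (hD.mulRight _))).1 h a rfl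
      exact AddLE.of_eq_of_addLE (hM.cod_cod_mul _ _).symm h
    · rintro H w rfl
      refine (map_convolution_addLE_iff hA hdec hM.codHom).2 fun v u hw => ?_
      refine (map_cod_addLE_iff hA hval (hM.codHom.comp (hD.mulRight _))).2 ?_
      rintro a rfl
      -- Dually, locality lifts composability of `t(a)` with `u` to that of `a` with `u`.
      obtain ⟨b, hb⟩ := hloc i a u (by
        rw [← Catoid.tgt_eq_src_of_mem_comp hw, Catoid.tgt_tgt])
      have h := (map_convolution_addLE_iff hA hdec hM.codHom).1 (H b (by
        rw [Catoid.tgt_of_mem_comp hw, Catoid.tgt_of_mem_comp hb])) a u hb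
      exact AddLE.of_eq_of_addLE (hM.cod_cod_mul _ _) h
  cod_le_one f := AddLE.pi_iff.2 fun x => by
    refine (cod_addLE_iff hA hval).2 ?_
    rintro y rfl
    change AddLE _ (indicatorOf _ _)
    rw [indicatorOf, if_pos (Catoid.mem_identities_tgt y)]
    exact (hA.isModalSemiring i).cod_le_one _
  cod_zero := by
    funext x
    refine eq_of_forall_addLE_iff (hA.isDioid i).add_idem fun c => ?_
    simp only [cod_addLE_iff hA hval, Pi.zero_apply, (hA.isModalSemiring i).cod_zero,
      AddLE.zero_le, implies_true]
  cod_add f g := by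
    have hid := (hA.isDioid i).add_idem
    funext x
    refine eq_of_forall_addLE_iff hid fun c => ?_
    rw [Pi.add_apply, add_addLE_iff hid, cod_addLE_iff hA hval, cod_addLE_iff hA hval,
      cod_addLE_iff hA hval]
    simp only [Pi.add_apply, (hA.isModalSemiring i).cod_add, add_addLE_iff hid, imp_and,
      forall_and]
  cod_dom f := by
    have hM := hA.isModalSemiring i
    funext x
    refine eq_of_forall_addLE_iff (hA.isDioid i).add_idem fun c => ?_
    rw [cod_addLE_iff hA hval, dom_addLE_iff hA hval]
    constructor
    · rintro H a rfl
      have h := (map_dom_addLE_iff hA hval hM.codHom).1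
        (H _ (Catoid.tgt_src _ a).symm) a rfl
      exact AddLE.of_eq_of_addLE (hM.cod_dom _).symm h
    · rintro H y rfl
      refine (map_dom_addLE_iff hA hval hM.codHom).2 ?_
      rintro a rfl
      exact AddLE.of_eq_of_addLE (hM.cod_dom _) (H a (Catoid.tgt_src _ a))
  dom_cod f := by
    have hM := hA.isModalSemiring i
    funext x
    refine eq_of_forall_addLE_iff (hA.isDioid i).add_idem fun c => ?_
    rw [dom_addLE_iff hA hval, cod_addLE_iff hA hval]
    constructor
    · rintro H a rfl
      have h := (map_cod_addLE_iff hA hval hM.domHom).1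
        (H _ (Catoid.src_tgt _ a).symm) a rfl
      exact AddLE.of_eq_of_addLE (hM.dom_cod _).symm h
    · rintro H y rfl
      refine (map_cod_addLE_iff hA hval hM.domHom).2 ?_
      rintro a rfl
      exact AddLE.of_eq_of_addLE (hM.dom_cod _) (H a (Catoid.src_tgt _ a))

/-! ### Axioms relating different dimensions. -/

theorem isNSemiring_convolution (hA : IsNSemiring A) (hdec : K.FinitelyTwoDecomposable)
    (hloc : K.IsLocal) (hval : K.FiniteValency) : IsNSemiring (convolutionOps K A) where
  isModalSemiring := isModalSemiring_convolution hA hdec hloc hval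
  dom_mul_le i j hij f g := AddLE.pi_iff.2 fun x => by
    refine addLE_of_forall (hA.isDioid i).add_idem fun c hc => ?_
    refine (dom_addLE_iff hA hval).2 ?_
    rintro w rfl
    refine (map_convolution_addLE_iff hA hdec (hA.isModalSemiring i).domHom).2 fun y z hw => ?_
    have h := (convolution_addLE_iff hA hdec).1 hc _ _
      (K.src_comp_subset i j hij y z (Set.mem_image_of_mem _ hw))
    have h := (mul_dom_dom_addLE_iff hA hval (AddMonoidHom.id S)).1 h y rfl z rfl
    exact (hA.dom_mul_le i j hij _ _).trans h
  cod_mul_le i j hij f g := AddLE.pi_iff.2 fun x => by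
    refine addLE_of_forall (hA.isDioid i).add_idem fun c hc => ?_
    refine (cod_addLE_iff hA hval).2 ?_
    rintro w rfl
    refine (map_convolution_addLE_iff hA hdec (hA.isModalSemiring i).codHom).2 fun y z hw => ?_
    have h := (convolution_addLE_iff hA hdec).1 hc _ _
      (K.tgt_comp_subset i j hij y z (Set.mem_image_of_mem _ hw))
    have h := (mul_cod_cod_addLE_iff hA hval (AddMonoidHom.id S)).1 h y rfl z rfl
    exact (hA.cod_mul_le i j hij _ _).trans h
  interchange i j hij f g h k := AddLE.pi_iff.2 fun p => by
    refine addLE_of_forall (hA.isDioid i).add_idem fun c hc => ?_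
    refine (convolution_addLE_iff hA hdec).2 fun u v hp => ?_
    refine (mul_convolution_convolution_addLE_iff hA hdec).2 fun w x hu y z hv => ?_
    -- Catoid interchange turns a decomposition of `p` indexing the left side into one indexing the
    -- right side, with the same four elements `w, x, y, z`.
    have hmem : p ∈ (K.cat j).setComp ((K.cat i).comp w y) ((K.cat i).comp x z) := by
      refine K.interchange i j hij w x y z ?_
      simp only [Catoid.setComp, Set.mem_iUnion]
      exact ⟨u, hu, v, hv, hp⟩
    simp only [Catoid.setComp, Set.mem_iUnion] at hmem
    obtain ⟨a, ha, b, hb, hp⟩ := hmem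
    have hab := (convolution_addLE_iff hA hdec).1 hc a b hp
    have hab := (mul_convolution_convolution_addLE_iff hA hdec).1 hab w y ha x z hb
    exact (hA.interchange i j hij _ _ _ _).trans hab
  dom_dom i j hij f := by
    have hM := hA.isModalSemiring j
    funext x
    refine eq_of_forall_addLE_iff (hA.isDioid i).add_idem fun c => ?_
    rw [dom_addLE_iff hA hval, dom_addLE_iff hA hval]
    constructor
    · rintro H a rfl
      have h := (map_dom_addLE_iff hA hval hM.domHom).1
        (H _ (K.src_src_of_lt i j hij a).symm) a rfl
      exact AddLE.of_eq_of_addLE (hA.dom_dom i j hij _).symm h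
    · rintro H y rfl
      refine (map_dom_addLE_iff hA hval hM.domHom).2 ?_
      rintro a rfl
      exact AddLE.of_eq_of_addLE (hA.dom_dom i j hij _) (H a (K.src_src_of_lt i j hij a))
  dom_closure i j hij f g := by
    have hM := hA.isModalSemiring j
    -- By the closure axiom of `K`, an `i`-composite of `j`-sources consists of `j`-sources, hence
    -- of fixpoints of the source map. Thus the outer `D⁻ⱼ` moves no point at which a summand
    -- contributes, and closure in `S` handles the values.
    have hfix : ∀ a b, ∀ y ∈ (K.cat i).comp ((K.cat j).src a) ((K.cat j).src b),
        (K.cat j).src y = y := by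
      intro a b y hy
      rw [← K.src_closure i j hij a b] at hy
      obtain ⟨z, -, rfl⟩ := hy
      exact Catoid.src_src _ z
    funext x
    refine eq_of_forall_addLE_iff (hA.isDioid i).add_idem fun c => ?_
    rw [dom_addLE_iff hA hval, convolution_addLE_iff hA hdec]
    constructor
    · intro H u v hx
      refine (mul_dom_dom_addLE_iff hA hval (AddMonoidHom.id S)).2 ?_
      rintro a rfl b rfl
      have h := (map_convolution_addLE_iff hA hdec hM.domHom).1
        (H x (hfix a b x hx).symm) _ _ hx
      have h := (mul_dom_dom_addLE_iff hA hval hM.domHom).1 h a rfl b rfl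
      exact AddLE.of_eq_of_addLE (hA.dom_closure i j hij _ _).symm h
    · rintro H y rfl
      refine (map_convolution_addLE_iff hA hdec hM.domHom).2 fun u v hy => ?_
      refine (mul_dom_dom_addLE_iff hA hval hM.domHom).2 ?_
      rintro a rfl b rfl
      have h := H _ _ ((hfix a b y hy).symm ▸ hy)
      have h := (mul_dom_dom_addLE_iff hA hval (AddMonoidHom.id S)).1 h a rfl b rfl
      exact AddLE.of_eq_of_addLE (hA.dom_closure i j hij _ _) h
  cod_closure i j hij f g := by
    have hM := hA.isModalSemiring j
    -- The dual fact: `i`-composites of `j`-targets are fixed by the `j`-target map.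
    have hfix : ∀ a b, ∀ y ∈ (K.cat i).comp ((K.cat j).tgt a) ((K.cat j).tgt b),
        (K.cat j).tgt y = y := by
      intro a b y hy
      rw [← K.tgt_closure i j hij a b] at hy
      obtain ⟨z, -, rfl⟩ := hy
      exact Catoid.tgt_tgt _ z
    funext x
    refine eq_of_forall_addLE_iff (hA.isDioid i).add_idem fun c => ?_
    rw [cod_addLE_iff hA hval, convolution_addLE_iff hA hdec]
    constructor
    · intro H u v hx
      refine (mul_cod_cod_addLE_iff hA hval (AddMonoidHom.id S)).2 ?_
      rintro a rfl b rfl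
      have h := (map_convolution_addLE_iff hA hdec hM.codHom).1
        (H x (hfix a b x hx).symm) _ _ hx
      have h := (mul_cod_cod_addLE_iff hA hval hM.codHom).1 h a rfl b rfl
      exact AddLE.of_eq_of_addLE (hA.cod_closure i j hij _ _).symm h
    · rintro H y rfl
      refine (map_convolution_addLE_iff hA hdec hM.codHom).2 fun u v hy => ?_
      refine (mul_cod_cod_addLE_iff hA hval hM.codHom).2 ?_
      rintro a rfl b rfl
      have h := H _ _ ((hfix a b y hy).symm ▸ hy)
      have h := (mul_cod_cod_addLE_iff hA hval (AddMonoidHom.id S)).1 h a rfl b rfl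
      exact AddLE.of_eq_of_addLE (hA.cod_closure i j hij _ _) h

end Convolution

theorem mainTheorem5 {n : ℕ} {C S : Type*} [AddCommMonoid S] (K : NCatoid n C)
    (A : NSemiringOps n S) (hA : IsNSemiring A) (hdec : K.FinitelyTwoDecomposable)
    (hloc : K.IsLocal) (hval : K.FiniteValency) :
    ((∀ (i : Fin n) (f g : C → S) (x : C), (Function.support (convTerm K A i f g x)).Finite) ∧
      (∀ (i : Fin n) (f : C → S) (x : C), (Function.support (domTerm K A i f x)).Finite) ∧
      (∀ (i : Fin n) (f : C → S) (x : C), (Function.support (codTerm K A i f x)).Finite)) ∧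
    IsNSemiring (convolutionOps K A) :=
  ⟨⟨finite_support_convTerm hA hdec, finite_support_domTerm hA hval,
    finite_support_codTerm hA hval⟩, isNSemiring_convolution hA hdec hloc hval⟩
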